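/- Let $E$ be a field, let $v$ be a henselian $\mathbb Z$-valuation on $E$ (a valuation with value group $\mathbb Z$ that extends uniquely to every finite field extension of $E$) such that $v(2)=0$, and let $\mathcal O_v$ be its valuation ring. Assume that the residue field of $v$ is separably closed. Let $E(X)$ be the rational function field in one variable over $E$, and let $\mathscr X$ be a model of $E(X)$ over $\mathcal O_v$, that is, a two-dimensional integral normal projective flat $\mathcal O_v$-scheme whose function field is isomorphic to $E(X)$ (for example, a regular one); identify the function field of $\mathscr X$ with $E(X)$ by any field isomorphism. Let $\Omega_{\mathscr X}$ be the set of $\mathbb Z$-valuations $w$ on $E(X)$ whose valuation ring is the local ring of $\mathscr X$ at a point of codimension one, and let $E(X)_w$ denote the completion of $E(X)$ with respect to $w$. Then there exists an anisotropic $4$-dimensional regular quadratic form $\langle a_1,a_2,a_3,a_4\rangle$ (with $a_1,\dots,a_4\in E(X)^\times$) over $E(X)$ which is isotropic over $E(X)_w$ for every $w\in\Omega_{\mathscr X}$. -/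

import Mathlib

open AlgebraicGeometry CategoryTheory
open scoped WithZero

universe u

noncomputable section

namespace LocalGlobalForms

/-- A `ℤ`-valuation: a valuation whose value group is exactly `ℤ` (written multiplicatively,
so that additive value `0` is `1` and additive value `∞` is `0`). -/
def IsZValuation {K : Type u} [Field K] (w : Valuation K ℤᵐ⁰) : Prop :=
  Function.Surjective w

/-- A valuation is henselian if it extends uniquely (up to equivalence, that is, as a valuation
ring) to every finite field extension. -/
def IsHenselianValuation {K : Type u} [Field K] (v : Valuation K ℤᵐ⁰) : Prop :=
  ∀ (L : Type u) [Field L] [Algebra K L] [FiniteDimensional K L],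
    ∃! A : ValuationSubring L, A.comap (algebraMap K L) = v.valuationSubring

/-- The residue field of a valuation. -/
abbrev residueField {K : Type u} [Field K] (v : Valuation K ℤᵐ⁰) : Type u :=
  IsLocalRing.ResidueField v.valuationSubring

/-- The canonical embedding of a field in its completion with respect to a valuation. -/
def toCompletion {K : Type u} [Field K] (w : Valuation K ℤᵐ⁰) : K →+* w.Completion :=
  (UniformSpace.Completion.coeRingHom : WithVal w →+* w.Completion).comp
    (WithVal.equiv w).symm.toRingHom

/-- The diagonal quadratic form `⟨a 0, …, a (n - 1)⟩` over `K`. -/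
abbrev diagForm {K : Type u} [Field K] {n : ℕ} (a : Fin n → K) : QuadraticForm K (Fin n → K) :=
  QuadraticMap.weightedSumSquares K a

attribute [local instance] MvPolynomial.gradedAlgebra

/-- The projective space of relative dimension `n` over `Spec R`. -/
abbrev projSpace (R : Type u) [CommRing R] (n : ℕ) : Scheme.{u} :=
  Proj (MvPolynomial.homogeneousSubmodule (Fin (n + 1)) R)

/-- The structure morphism of projective space over `Spec R`. -/
def projSpaceToSpec (R : Type u) [CommRing R] (n : ℕ) : projSpace R n ⟶ Spec (.of R) :=
  Proj.toSpecZero (MvPolynomial.homogeneousSubmodule (Fin (n + 1)) R) ≫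
    Spec.map (CommRingCat.ofHom
      (algebraMap R (MvPolynomial.homogeneousSubmodule (Fin (n + 1)) R 0)))

/-- A morphism to `Spec R` is projective if it factors as a closed immersion into some projective
space over `Spec R` followed by the structure morphism. -/
def IsProjectiveOver {R : Type u} [CommRing R] {𝒳 : Scheme.{u}} (f : 𝒳 ⟶ Spec (.of R)) : Prop :=
  ∃ (n : ℕ) (i : 𝒳 ⟶ projSpace R n), IsClosedImmersion i ∧ i ≫ projSpaceToSpec R n = f

/-- A model over `R` of the field `F`: a two-dimensional integral normal projective flat scheme
over `R` whose function field is isomorphic to `F`. -/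
structure IsModel (R : Type u) [CommRing R] (F : Type u) [Field F]
    (𝒳 : Scheme.{u}) [IsIntegral 𝒳] (f : 𝒳 ⟶ Spec (.of R)) : Prop where
  dim_eq_two : topologicalKrullDim 𝒳 = 2
  normal : ∀ x : 𝒳, IsIntegrallyClosed (𝒳.presheaf.stalk x)
  projective : IsProjectiveOver f
  flat : Flat f
  functionField_equiv : Nonempty (𝒳.functionField ≃+* F)

/-- Given an identification `φ` of the function field of `𝒳` with `F`, the set of `ℤ`-valuations
on `F` whose valuation ring is the local ring of `𝒳` at some point of codimension one. -/
def divisorialValuations (𝒳 : Scheme.{u}) [IsIntegral 𝒳] {F : Type u} [Field F]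
    (φ : 𝒳.functionField ≃+* F) : Set (Valuation F ℤᵐ⁰) :=
  {w | IsZValuation w ∧ ∃ x : 𝒳, Order.coheight x = 1 ∧
    w.integer = (φ.toRingHom.comp (algebraMap (𝒳.presheaf.stalk x) 𝒳.functionField)).range}

end LocalGlobalForms

end

/-! Let `t` be a uniformizer of `v`, `Y = X / t ^ N`, and consider the form `⟨1, -(Y² - 1), t, -t(Y²
+ 1)⟩`.

It is anisotropic for every `N`, by Springer's argument for the Gauss extension of `v` to `E(Y)`:
the residue forms `⟨1, -(Y² - 1)⟩` and `⟨1, -(Y² + 1)⟩` are anisotropic because `Y² ∓ 1` is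
nonconstant and squarefree in residue characteristic different from `2` (`anisotropic_diagForm`).

It becomes isotropic wherever `Y² - 1` or `Y² + 1` is a square. Units of `v` are infinitely
2-divisible, so each `w` in `Ω` has value `1` on them, and `w t ≤ 1`. If `w t < 1`, then `w` comes
from one of the finitely many prime divisors on which `t` is not a unit; a large `N` gives `Y` a
pole along all of them, and `Y² - 1` is a square in the completion. If `w t = 1`, then `w` is
trivial on `E`. Either `Y` has a pole again, or its residue `y` generates a finite extension of `E`;
there units are squares, which forces `y² - 1` or `y² + 1` to be a nonzero square
(`exists_sq_eq_sq_sub_one_or_sq_add_one`), and the root lifts to the completion. -/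

noncomputable section

/-! ### Valuation rings and residue fields in algebraic extensions -/

namespace ValuationSubring

section Comap

variable {K L : Type*} [Field K] [Field L]

theorem mem_nonunits_comap_iff (A : ValuationSubring L) (f : K →+* L) (x : K) :
    x ∈ (A.comap f).nonunits ↔ f x ∈ A.nonunits := by
  rw [mem_nonunits_iff_or, mem_nonunits_iff_or, mem_comap, map_inv₀, map_eq_zero]

theorem valuation_comap_eq_one_iff (A : ValuationSubring L) (f : K →+* L) (x : K) :
    (A.comap f).valuation x = 1 ↔ A.valuation (f x) = 1 := by
  have h1 : (A.comap f).valuation x ≤ 1 ↔ A.valuation (f x) ≤ 1 := by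
    rw [valuation_le_one_iff, valuation_le_one_iff, mem_comap]
  have h2 := mem_nonunits_comap_iff A f x
  rw [mem_nonunits_iff, mem_nonunits_iff] at h2
  rw [le_antisymm_iff, le_antisymm_iff, h1, ← not_lt (b := (1 : A.ValueGroup)), ← h2, not_lt]

/-- The inclusion of valuation rings induced by a field extension. -/
def mapOfComapEq {B : ValuationSubring K} (A : ValuationSubring L) (f : K →+* L)
    (h : A.comap f = B) : B →+* A :=
  f.restrict B.toSubring A.toSubring fun x hx ↦ by
    rw [mem_toSubring, ← h] at hx
    exact hx


theorem isLocalHom_mapOfComapEq {B : ValuationSubring K} (A : ValuationSubring L) (f : K →+* L)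
    (h : A.comap f = B) : IsLocalHom (mapOfComapEq A f h) where
  map_nonunit x hx := by
    rw [valuation_eq_one_iff] at hx ⊢
    subst h
    exact (valuation_comap_eq_one_iff A f x).2 hx

end Comap

section Residue

variable {K L : Type*} [Field K] [Field L] [Algebra K L]

/-- Divide an algebraic equation by a coefficient of maximal value. The coefficient `1` need not be
the leading one; it only ensures that the reduction is nonzero. -/
theorem exists_polynomial_aeval_eq_zero [Algebra.IsAlgebraic K L] (B : ValuationSubring K) (a : L) :
    ∃ (Q : Polynomial B) (i : ℕ), Q.coeff i = 1 ∧
      Polynomial.aeval a (Q.map B.subtype) = 0 := by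
  obtain ⟨p, hp0, hp⟩ := Algebra.IsAlgebraic.isAlgebraic (R := K) a
  obtain ⟨i, hi, hmax⟩ := Finset.exists_max_image p.support (fun j ↦ B.valuation (p.coeff j))
    (Polynomial.support_nonempty.2 hp0)
  have hci : p.coeff i ≠ 0 := Polynomial.mem_support_iff.1 hi
  have hv : B.valuation (p.coeff i) ≠ 0 := (Valuation.ne_zero_iff _).2 hci
  have hl : Polynomial.C (p.coeff i)⁻¹ * p ∈ Polynomial.lifts B.subtype := by
    rw [Polynomial.lifts_iff_coeff_lifts]
    intro n
    refine ⟨⟨(Polynomial.C (p.coeff i)⁻¹ * p).coeff n, ?_⟩, rfl⟩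
    rw [← valuation_le_one_iff, Polynomial.coeff_C_mul, map_mul, map_inv₀]
    by_cases hn : n ∈ p.support
    · rw [inv_mul_le_iff₀ (zero_lt_iff.2 hv), mul_one]
      exact hmax n hn
    · simp [Polynomial.notMem_support_iff.1 hn]
  obtain ⟨Q, hQ⟩ := (Polynomial.mem_lifts _).1 hl
  refine ⟨Q, i, ?_, ?_⟩
  · apply B.subtype_injective
    rw [← Polynomial.coeff_map, hQ, Polynomial.coeff_C_mul, inv_mul_cancel₀ hci, map_one]
  · rw [hQ, map_mul, hp, mul_zero]

theorem isSepClosed_residueField [Algebra.IsAlgebraic K L] {B : ValuationSubring K}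
    (A : ValuationSubring L) (h : A.comap (algebraMap K L) = B)
    [IsSepClosed (IsLocalRing.ResidueField B)] : IsSepClosed (IsLocalRing.ResidueField A) := by
  have := isLocalHom_mapOfComapEq A (algebraMap K L) h
  let := (IsLocalRing.ResidueField.map (mapOfComapEq A (algebraMap K L) h)).toAlgebra
  have : Algebra.IsAlgebraic (IsLocalRing.ResidueField B) (IsLocalRing.ResidueField A) := by
    refine ⟨fun x ↦ ?_⟩
    obtain ⟨a, rfl⟩ := IsLocalRing.residue_surjective x
    obtain ⟨Q, i, hi, hQ⟩ := exists_polynomial_aeval_eq_zero (L := L) B a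
    refine ⟨Q.map (IsLocalRing.residue B), fun h0 ↦ ?_, ?_⟩
    · have := congrArg (Polynomial.coeff · i) h0
      simp [hi] at this
    · rw [Polynomial.aeval_def, Polynomial.eval₂_map]
      have h1 : Polynomial.eval₂ (mapOfComapEq A (algebraMap K L) h) a Q = 0 := by
        apply A.subtype_injective
        rw [Polynomial.hom_eval₂, map_zero, ← hQ, Polynomial.aeval_def, Polynomial.eval₂_map]
        rfl
      have h2 := congrArg (IsLocalRing.residue A) h1
      rw [Polynomial.hom_eval₂, map_zero] at h2
      exact h2
  exact Algebra.IsAlgebraic.isSepClosed (F := IsLocalRing.ResidueField B)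

/-- Over a valuation ring with separably closed residue field and `2` invertible, units are squares
modulo the maximal ideal. -/
theorem exists_valuation_sub_sq_lt_one (A : ValuationSubring K)
    [IsSepClosed (IsLocalRing.ResidueField A)] (h2 : A.valuation 2 = 1) (u : K)
    (hu : A.valuation u = 1) : ∃ a, A.valuation a = 1 ∧ A.valuation (u - a ^ 2) < 1 := by
  have hmem : u ∈ A := (valuation_le_one_iff A u).1 hu.le
  have : NeZero (2 : IsLocalRing.ResidueField A) := by
    refine ⟨fun h ↦ ?_⟩
    have h' : IsLocalRing.residue A 2 = 0 := by rw [map_ofNat, h]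
    rw [IsLocalRing.residue_eq_zero_iff] at h'
    exact ((valuation_lt_one_iff A _).1 h').ne h2
  obtain ⟨z, hz⟩ := IsSepClosed.exists_eq_mul_self (IsLocalRing.residue A ⟨u, hmem⟩)
  obtain ⟨a, rfl⟩ := IsLocalRing.residue_surjective z
  have hlt : A.valuation (u - (a : K) ^ 2) < 1 := by
    have : IsLocalRing.residue A (⟨u, hmem⟩ - a ^ 2) = 0 := by
      rw [map_sub, hz, map_pow, pow_two, sub_self]
    rw [IsLocalRing.residue_eq_zero_iff] at this
    exact (valuation_lt_one_iff A _).1 this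
  refine ⟨a, ?_, hlt⟩
  have h3 : A.valuation ((a : K) ^ 2) = 1 := by
    rw [← hu]
    apply Valuation.map_eq_of_sub_lt
    rwa [hu, Valuation.map_sub_swap]
  rw [map_pow] at h3
  exact (pow_eq_one_iff_of_nonneg zero_le two_ne_zero).1 h3

end Residue

end ValuationSubring

/-! ### Squares in finite extensions of a henselian field -/

namespace LocalGlobalForms

section Henselian

variable {E : Type u} [Field E] {v : Valuation E ℤᵐ⁰}

theorem valuation_eq_one_of_comap_eq {L : Type*} [Field L] [Algebra E L] {A : ValuationSubring L}
    (hA : A.comap (algebraMap E L) = v.valuationSubring) {x : E} (hx : v x = 1) :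
    A.valuation (algebraMap E L x) = 1 := by
  rw [← ValuationSubring.valuation_comap_eq_one_iff, hA,
    ← (Valuation.isEquiv_valuation_valuationSubring v).eq_one_iff_eq_one, hx]

/-- In a quadratic extension of a henselian field, a valuation ring is stable under conjugation,
hence units that are squares modulo the maximal ideal are squares. -/
theorem isSquare_of_valuation_sub_sq_lt_one (hens : IsHenselianValuation v) (h2 : v 2 = 1)
    {L : Type u} [Field L] [Algebra E L] [FiniteDimensional E L] (A : ValuationSubring L)
    (hA : A.comap (algebraMap E L) = v.valuationSubring) {u a : L} (ha : A.valuation a = 1)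
    (hua : A.valuation (u - a ^ 2) < 1) : IsSquare u := by
  by_contra hsq
  have hirr : Irreducible (Polynomial.X ^ 2 - Polynomial.C u) :=
    X_pow_sub_C_irreducible_of_prime Nat.prime_two fun b hb ↦ hsq ⟨b, by rw [← hb, pow_two]⟩
  have : Fact (Irreducible (Polynomial.X ^ 2 - Polynomial.C u)) := ⟨hirr⟩
  let M := AdjoinRoot (Polynomial.X ^ 2 - Polynomial.C u)
  have : FiniteDimensional L M :=
    (AdjoinRoot.powerBasis hirr.ne_zero).finite
  have : FiniteDimensional E M := FiniteDimensional.trans E L M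
  let r : M := AdjoinRoot.root _
  have hr : r ^ 2 = algebraMap L M u := by
    have := AdjoinRoot.eval₂_root (Polynomial.X ^ 2 - Polynomial.C u)
    rw [Polynomial.eval₂_sub, Polynomial.eval₂_pow, Polynomial.eval₂_X, Polynomial.eval₂_C,
      sub_eq_zero] at this
    exact this
  let σ : M →ₐ[L] M := AdjoinRoot.liftAlgHom _ (Algebra.ofId L M) (-r) (by
    rw [Polynomial.eval₂_sub, Polynomial.eval₂_pow, Polynomial.eval₂_X, Polynomial.eval₂_C,
      neg_sq, hr]
    exact sub_self _)
  have hσr : σ r = -r := AdjoinRoot.liftAlgHom_root ..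
  obtain ⟨B, hB, hBu⟩ := hens M
  -- Uniqueness over `L` puts `B` above `A`; uniqueness over `M` then makes `B` stable under the
  -- conjugation `σ`.
  have hBA : B.comap (algebraMap L M) = A := by
    refine (hens L).unique ?_ hA
    rw [ValuationSubring.comap_comap, ← IsScalarTower.algebraMap_eq, hB]
  have hσB : B.comap (σ : M →+* M) = B := by
    refine hBu _ ?_
    change (B.comap (σ : M →+* M)).comap (algebraMap E M) = _
    rw [ValuationSubring.comap_comap, ← hB]
    congr 1
    ext x
    simp only [RingHom.coe_comp, Function.comp_apply, IsScalarTower.algebraMap_apply E L M]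
    exact σ.commutes _
  have hσ (x : M) : B.valuation (σ x) < 1 ↔ B.valuation x < 1 := by
    have := ValuationSubring.mem_nonunits_comap_iff B (σ : M →+* M) x
    rw [hσB] at this
    exact this.symm
  set b : M := algebraMap L M a with hb
  have hσb : σ b = b := σ.commutes a
  have hvb : B.valuation b = 1 := by
    rw [← ValuationSubring.valuation_comap_eq_one_iff, hBA, ha]
  have hprod : B.valuation (r - b) * B.valuation (r + b) < 1 := by
    rw [← map_mul]
    have : (r - b) * (r + b) = algebraMap L M (u - a ^ 2) := by
      rw [map_sub, map_pow, ← hr, mul_comm, ← sq_sub_sq]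
    rw [this]
    have h := ValuationSubring.mem_nonunits_comap_iff B (algebraMap L M) (u - a ^ 2)
    rw [hBA] at h
    exact h.1 hua
  -- `σ` sends `r - b` to `-(r + b)`, so both factors of the nonunit `u - a²` are nonunits, and so
  -- is their difference `2b`, a contradiction.
  have hequiv : B.valuation (r - b) < 1 ↔ B.valuation (r + b) < 1 := by
    rw [← hσ (r - b), map_sub, hσr, hσb, ← Valuation.map_neg, neg_sub,
      sub_neg_eq_add, add_comm]
  have hboth : B.valuation (r - b) < 1 ∧ B.valuation (r + b) < 1 := by
    by_contra hcon
    have h1 : 1 ≤ B.valuation (r - b) := by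
      by_contra hc; rw [not_le] at hc; exact hcon ⟨hc, hequiv.1 hc⟩
    have h2 : 1 ≤ B.valuation (r + b) := by
      by_contra hc; rw [not_le] at hc; exact hcon ⟨hequiv.2 hc, hc⟩
    exact absurd hprod (not_lt.2 (one_le_mul h1 h2))
  have hlt : B.valuation (2 * b) < 1 := by
    have : 2 * b = (r + b) - (r - b) := by rw [add_sub_sub_cancel, two_mul]
    rw [this]
    exact Valuation.map_sub_lt _ hboth.2 hboth.1
  have h2' : B.valuation (2 : M) = 1 := by
    have := valuation_eq_one_of_comap_eq hB h2
    rwa [map_ofNat] at this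
  rw [map_mul, h2', hvb, one_mul] at hlt
  exact lt_irrefl _ hlt

theorem isSquare_of_valuation_eq_one (hens : IsHenselianValuation v) (h2 : v 2 = 1)
    (hsep : IsSepClosed (residueField v))
    {L : Type u} [Field L] [Algebra E L] [FiniteDimensional E L] (A : ValuationSubring L)
    (hA : A.comap (algebraMap E L) = v.valuationSubring) {u : L} (hu : A.valuation u = 1) :
    IsSquare u := by
  have : IsSepClosed (IsLocalRing.ResidueField v.valuationSubring) := hsep
  have := ValuationSubring.isSepClosed_residueField A hA
  have h2' : A.valuation (2 : L) = 1 := by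
    have := valuation_eq_one_of_comap_eq hA h2
    rwa [map_ofNat] at this
  obtain ⟨a, ha, hua⟩ := A.exists_valuation_sub_sq_lt_one h2' u hu
  exact isSquare_of_valuation_sub_sq_lt_one hens h2 A hA ha hua

theorem isSquare_of_apply_eq_one (hens : IsHenselianValuation v) (h2 : v 2 = 1)
    (hsep : IsSepClosed (residueField v)) {u : E} (hu : v u = 1) : IsSquare u :=
  isSquare_of_valuation_eq_one hens h2 hsep (L := E) v.valuationSubring (by ext; rfl)
    ((Valuation.isEquiv_valuation_valuationSubring v).eq_one_iff_eq_one.1 hu)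

/-- For algebraic `y`, one of `y² - 1` and `y² + 1` is a nonzero square. -/
theorem exists_sq_eq_sq_sub_one_or_sq_add_one (hens : IsHenselianValuation v) (h2 : v 2 = 1)
    (hsep : IsSepClosed (residueField v)) {κ : Type u} [Field κ] [Algebra E κ] {y : κ}
    (hy : IsAlgebraic E y) : ∃ s : κ, s ≠ 0 ∧ (s ^ 2 = y ^ 2 - 1 ∨ s ^ 2 = y ^ 2 + 1) := by
  let L := IntermediateField.adjoin E {y}
  have : FiniteDimensional E L := IntermediateField.adjoin.finiteDimensional hy.isIntegral
  obtain ⟨A, hA, -⟩ := hens L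
  have key {u : L} (hu : A.valuation u = 1) : ∃ s : L, s ≠ 0 ∧ s ^ 2 = u := by
    obtain ⟨s, hs⟩ := isSquare_of_valuation_eq_one hens h2 hsep A hA hu
    refine ⟨s, ?_, by rw [hs, pow_two]⟩
    rintro rfl
    simp [hs] at hu
  let z : L := ⟨y, IntermediateField.mem_adjoin_simple_self E y⟩
  suffices h : ∃ s : L, s ≠ 0 ∧ (s ^ 2 = z ^ 2 - 1 ∨ s ^ 2 = z ^ 2 + 1) by
    obtain ⟨s, hs0, hs⟩ := h
    refine ⟨s, by simpa using hs0, ?_⟩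
    refine hs.imp (fun h ↦ ?_) (fun h ↦ ?_)
    · simpa using congrArg (Subtype.val) h
    · simpa using congrArg (Subtype.val) h
  have h2' : A.valuation (2 : L) = 1 := by
    have := valuation_eq_one_of_comap_eq hA h2
    rwa [map_ofNat] at this
  rcases le_or_gt (A.valuation z) 1 with hz | hz
  · have hz2 : A.valuation (z ^ 2) ≤ 1 := by rw [map_pow]; exact pow_le_one' hz 2
    have hm : A.valuation (z ^ 2 - 1) ≤ 1 := A.valuation.map_sub_le hz2 (map_one _).le
    have hp : A.valuation (z ^ 2 + 1) ≤ 1 := Valuation.map_add_le _ hz2 (map_one _).le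
    -- The integral elements `z² + 1` and `z² - 1` differ by the unit `2`, so one of them is a unit.
    rcases hm.lt_or_eq with hm | hm
    · rcases hp.lt_or_eq with hp | hp
      · have : (2 : L) = (z ^ 2 + 1) - (z ^ 2 - 1) := by ring
        rw [this] at h2'
        exact absurd h2' (Valuation.map_sub_lt _ hp hm).ne
      · obtain ⟨s, hs0, hs⟩ := key hp
        exact ⟨s, hs0, Or.inr hs⟩
    · obtain ⟨s, hs0, hs⟩ := key hm
      exact ⟨s, hs0, Or.inl hs⟩
  · have hz0 : z ≠ 0 := by rintro h; rw [h, map_zero] at hz; exact not_lt_zero hz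
    have hlt : A.valuation ((z⁻¹) ^ 2) < 1 := by
      rw [map_pow, map_inv₀]
      exact pow_lt_one₀ zero_le (inv_lt_one_of_one_lt₀ hz) two_ne_zero
    have : A.valuation (1 - (z⁻¹) ^ 2) = 1 := Valuation.map_one_sub_of_lt _ hlt
    obtain ⟨s, hs0, hs⟩ := key this
    refine ⟨z * s, mul_ne_zero hz0 hs0, Or.inl ?_⟩
    rw [mul_pow, hs]
    field_simp

end Henselian

end LocalGlobalForms

/-! ### Square roots in completions -/

namespace Valued

variable {K Γ₀ : Type*} [Ring K] [LinearOrderedCommGroupWithZero Γ₀] [Valued K Γ₀]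

theorem nonarchimedeanAddGroup : NonarchimedeanAddGroup K where
  is_nonarchimedean U hU := by
    obtain ⟨γ, hγ⟩ := Valued.mem_nhds_zero.1 hU
    exact ⟨⟨Valued.v.restrict.ltAddSubgroup γ, Valued.isOpen_ball K γ.1⟩, hγ⟩

open Filter Topology in
theorem tendsto_zero_of_le_pow [MulArchimedean Γ₀] {f : ℕ → K} {γ : Γ₀} (hγ : γ < 1)
    (hf : ∀ n, Valued.v (f n) ≤ γ ^ n) : Tendsto f atTop (𝓝 0) := by
  rw [(Valued.hasBasis_nhds_zero K Γ₀).tendsto_right_iff]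
  intro y _
  obtain ⟨n, hn⟩ := exists_pow_lt₀ hγ
    (Units.map (MonoidWithZeroHom.ValueGroup₀.embedding (f := .ofClass (Valued.v (R := K)))) y)
  filter_upwards [eventually_ge_atTop n] with m hm
  rw [Valuation.restrict_lt_iff_lt_embedding]
  exact ((hf m).trans (pow_le_pow_right_of_le_one' hγ.le hm)).trans_lt hn

end Valued

namespace LocalGlobalForms

section Completion

variable {K : Type u} [Field K] {w : Valuation K ℤᵐ⁰}

/-- Newton iteration for the square root of `u`. -/
def sqrtIter (u : K) : ℕ → K
  | 0 => 1
  | n + 1 => sqrtIter u n - (sqrtIter u n ^ 2 - u) / (2 * sqrtIter u n)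

/-- Each Newton step replaces the error by the square of error`/(2x)`, whose denominator is a unit.
The convergence is quadratic, but the weaker geometric bound suffices. -/
theorem apply_sqrtIter_eq_one_and_le (h2 : w 2 = 1) {u : K} (hu : w (1 - u) < 1) (n : ℕ) :
    w (sqrtIter u n) = 1 ∧ w (sqrtIter u n ^ 2 - u) ≤ w (1 - u) ^ (n + 1) := by
  induction n with
  | zero => simp [sqrtIter]
  | succ n ih =>
    obtain ⟨h1, hle⟩ := ih
    have h20 : (2 : K) ≠ 0 := fun h ↦ by rw [h, map_zero] at h2; exact zero_ne_one h2
    have hx0 : sqrtIter u n ≠ 0 := fun h ↦ by rw [h, map_zero] at h1; exact zero_ne_one h1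
    have hlt : w (1 - u) ^ (n + 1) < 1 := pow_lt_one₀ zero_le hu n.succ_ne_zero
    have hq : w ((sqrtIter u n ^ 2 - u) / (2 * sqrtIter u n)) = w (sqrtIter u n ^ 2 - u) := by
      rw [map_div₀, map_mul, h2, h1, one_mul, div_one]
    refine ⟨?_, ?_⟩
    · rw [sqrtIter, Valuation.map_sub_eq_of_lt_left, h1]
      rw [hq, h1]
      exact hle.trans_lt hlt
    · have : sqrtIter u (n + 1) ^ 2 - u =
          ((sqrtIter u n ^ 2 - u) / (2 * sqrtIter u n)) ^ 2 := by
        rw [sqrtIter]; field_simp; ring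
      rw [this, map_pow, hq, sq (w _), pow_succ (w _)]
      refine mul_le_mul' hle (hle.trans ?_)
      rw [pow_succ]
      exact mul_le_of_le_one_left' (pow_le_one' hu.le n)

open Filter Topology in
/-- One-units are squares in the completion. -/
theorem isSquare_toCompletion_of_one_sub (h2 : w 2 = 1) {u : K} (hu : w (1 - u) < 1) :
    IsSquare (toCompletion w u) := by
  have : NonarchimedeanAddGroup (WithVal w) := Valued.nonarchimedeanAddGroup
  have h20 : (2 : K) ≠ 0 := fun h ↦ by rw [h, map_zero] at h2; exact zero_ne_one h2
  let x (n : ℕ) : WithVal w := WithVal.toVal w (sqrtIter u n)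
  have hle (n : ℕ) : w (sqrtIter u n ^ 2 - u) ≤ w (1 - u) ^ n :=
    (apply_sqrtIter_eq_one_and_le h2 hu n).2.trans (pow_le_pow_right_of_le_one' hu.le n.le_succ)
  have hcauchy : CauchySeq x := by
    apply NonarchimedeanAddGroup.cauchySeq_of_tendsto_sub_nhds_zero
    refine Valued.tendsto_zero_of_le_pow hu fun n ↦ ?_
    have h1 := (apply_sqrtIter_eq_one_and_le h2 hu n).1
    have : x (n + 1) - x n =
        WithVal.toVal w (-((sqrtIter u n ^ 2 - u) / (2 * sqrtIter u n))) := by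
      rw [← WithVal.toVal_sub, sqrtIter, sub_sub_cancel_left]
    rw [this, WithVal.valued_toVal, Valuation.map_neg, map_div₀, map_mul, h2, h1, one_mul, div_one]
    exact hle n
  have hzero : Tendsto (fun n ↦ x n ^ 2 - WithVal.toVal w u) atTop (𝓝 0) := by
    refine Valued.tendsto_zero_of_le_pow hu fun n ↦ ?_
    rw [← WithVal.toVal_pow, ← WithVal.toVal_sub, WithVal.valued_toVal]
    exact hle n
  obtain ⟨s, hs⟩ := cauchySeq_tendsto_of_complete
    ((UniformSpace.Completion.uniformContinuous_coe (WithVal w)).comp_cauchySeq hcauchy)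
  have hlim := ((UniformSpace.Completion.continuous_coe (WithVal w)).tendsto 0).comp hzero
  have hlim2 := (hs.pow 2).sub_const (toCompletion w u)
  have heq : s ^ 2 - toCompletion w u = ((0 : WithVal w) : w.Completion) := by
    refine tendsto_nhds_unique hlim2 (hlim.congr fun n ↦ ?_)
    simp only [Function.comp_apply]
    rw [UniformSpace.Completion.coe_sub, pow_two, UniformSpace.Completion.coe_mul, pow_two]
    rfl
  rw [UniformSpace.Completion.coe_zero, sub_eq_zero] at heq
  exact ⟨s, by rw [← heq, pow_two]⟩

theorem isSquare_toCompletion_of_sub_sq (h2 : w 2 = 1) {z s : K} (hs : s ≠ 0)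
    (h : w (s ^ 2 - z) < w (s ^ 2)) : IsSquare (toCompletion w z) := by
  have hs2 : s ^ 2 ≠ 0 := pow_ne_zero 2 hs
  have hw : w (1 - z / s ^ 2) < 1 := by
    rw [one_sub_div hs2, map_div₀]
    exact (div_lt_one₀ (zero_lt_iff.2 ((Valuation.ne_zero_iff w).2 hs2))).2 h
  obtain ⟨t, ht⟩ := isSquare_toCompletion_of_one_sub h2 hw
  refine ⟨toCompletion w s * t, ?_⟩
  rw [mul_mul_mul_comm, ← ht, ← pow_two, ← map_pow, ← map_mul, mul_div_cancel₀ _ hs2]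

/-- The forms `⟨1, -f, p, -pg⟩` are isotropic when `f` or `g` is a square. -/
theorem not_anisotropic_of_isSquare {F : Type u} [Field F] {a : Fin 4 → F} {f g p : F}
    (ha : a = ![1, -f, p, -(p * g)]) (h : IsSquare f ∨ IsSquare g) :
    ¬ (diagForm a).Anisotropic := by
  intro han
  subst ha
  rcases h with ⟨s, rfl⟩ | ⟨s, rfl⟩
  · have := han ![s, 1, 0, 0] (by
      simp [QuadraticMap.weightedSumSquares_apply, Fin.sum_univ_four])
    simpa using congrFun this 1
  · have := han ![0, 0, s, 1] (by
      simp [QuadraticMap.weightedSumSquares_apply, Fin.sum_univ_four])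
    simpa using congrFun this 3

end Completion

end LocalGlobalForms

/-! ### Anisotropy over the rational function field -/

open scoped Polynomial

namespace Polynomial

/-- A nonconstant squarefree polynomial is not a quotient of two squares. -/
theorem eq_zero_of_sq_eq_squarefree_mul_sq {k : Type*} [Field k] {h p q : k[X]}
    (hh : Squarefree h) (hu : ¬ IsUnit h) (heq : p ^ 2 = h * q ^ 2) : p = 0 ∧ q = 0 := by
  have hq : q = 0 := by
    by_contra hq
    have hdvd : q ∣ p :=
      (IsIntegrallyClosed.pow_dvd_pow_iff two_ne_zero).1 ⟨h, by rw [heq, mul_comm]⟩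
    obtain ⟨r, rfl⟩ := hdvd
    have hr : h = r * r := by
      apply mul_right_cancel₀ (pow_ne_zero 2 hq)
      rw [← heq]; ring
    exact hu (hr ▸ (hh r ⟨1, by rw [hr, mul_one]⟩).mul (hh r ⟨1, by rw [hr, mul_one]⟩))
  refine ⟨?_, hq⟩
  rwa [hq, zero_pow two_ne_zero, mul_zero, pow_eq_zero_iff two_ne_zero] at heq

theorem eq_zero_of_sq_eq_X_sq_sub_C_mul_sq {k : Type*} [Field k] (h2 : (2 : k) ≠ 0) {a : k}
    (ha : a ≠ 0) {p q : k[X]} (heq : p ^ 2 = (X ^ 2 - C a) * q ^ 2) : p = 0 ∧ q = 0 :=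
  eq_zero_of_sq_eq_squarefree_mul_sq
    (separable_X_pow_sub_C a (by exact_mod_cast h2) ha).squarefree
    (not_isUnit_of_natDegree_pos _ (by rw [natDegree_X_pow_sub_C]; exact two_pos)) heq

section Reduction

variable {R : Type*} [CommRing R] [IsLocalRing R] {t : R}

theorem C_dvd_of_map_residue_eq_zero (ht : IsLocalRing.maximalIdeal R = Ideal.span {t}) {p : R[X]}
    (h : p.map (IsLocalRing.residue R) = 0) : C t ∣ p := by
  rw [C_dvd_iff_dvd_coeff]
  intro i
  rw [← Ideal.mem_span_singleton, ← ht, ← IsLocalRing.residue_eq_zero_iff, ← coeff_map, h,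
    coeff_zero]

variable [IsDomain R]

/-- Two successive reductions modulo the maximal ideal, as in Springer's theorem. -/
theorem exists_eq_C_mul_of_springer (ht : IsLocalRing.maximalIdeal R = Ideal.span {t})
    (ht0 : t ≠ 0) (h2 : IsUnit (2 : R)) {p₁ p₂ p₃ p₄ : R[X]}
    (h : p₁ ^ 2 - (X ^ 2 - 1) * p₂ ^ 2 + C t * (p₃ ^ 2 - (X ^ 2 + 1) * p₄ ^ 2) = 0) :
    ∃ q₁ q₂ q₃ q₄ : R[X], p₁ = C t * q₁ ∧ p₂ = C t * q₂ ∧ p₃ = C t * q₃ ∧ p₄ = C t * q₄ ∧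
      q₁ ^ 2 - (X ^ 2 - 1) * q₂ ^ 2 + C t * (q₃ ^ 2 - (X ^ 2 + 1) * q₄ ^ 2) = 0 := by
  have hres : IsLocalRing.residue R t = 0 := by
    rw [IsLocalRing.residue_eq_zero_iff, ht]
    exact Ideal.mem_span_singleton_self t
  have h2' : (2 : IsLocalRing.ResidueField R) ≠ 0 := by
    have := h2.map (IsLocalRing.residue R)
    rw [map_ofNat] at this
    exact this.ne_zero
  have hCt : (C t : R[X]) ≠ 0 := C_ne_zero.2 ht0
  have hm := congrArg (Polynomial.map (IsLocalRing.residue R)) h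
  simp only [Polynomial.map_add, Polynomial.map_sub, Polynomial.map_mul, Polynomial.map_pow, map_X,
    Polynomial.map_one, map_C, hres, map_zero, zero_mul, add_zero, Polynomial.map_zero] at hm
  -- First residue form. Once `p₁` and `p₂` are divisible by `t`, one factor `t` cancels and the
  -- second residue form appears.
  obtain ⟨h₁, h₂⟩ := eq_zero_of_sq_eq_X_sq_sub_C_mul_sq h2' one_ne_zero
    (by rw [map_one]; exact sub_eq_zero.1 hm)
  obtain ⟨q₁, rfl⟩ := C_dvd_of_map_residue_eq_zero ht h₁
  obtain ⟨q₂, rfl⟩ := C_dvd_of_map_residue_eq_zero ht h₂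
  have h' : C t * (q₁ ^ 2 - (X ^ 2 - 1) * q₂ ^ 2) + (p₃ ^ 2 - (X ^ 2 + 1) * p₄ ^ 2) = 0 := by
    apply mul_left_cancel₀ hCt
    rw [mul_zero, ← h]; ring
  have hm := congrArg (Polynomial.map (IsLocalRing.residue R)) h'
  simp only [Polynomial.map_add, Polynomial.map_sub, Polynomial.map_mul, Polynomial.map_pow, map_X,
    Polynomial.map_one, map_C, hres, map_zero, zero_mul, zero_add, Polynomial.map_zero] at hm
  obtain ⟨h₃, h₄⟩ := eq_zero_of_sq_eq_X_sq_sub_C_mul_sq h2' (neg_ne_zero.2 one_ne_zero)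
    (by rw [map_neg, map_one, sub_neg_eq_add]; exact sub_eq_zero.1 hm)
  obtain ⟨q₃, rfl⟩ := C_dvd_of_map_residue_eq_zero ht h₃
  obtain ⟨q₄, rfl⟩ := C_dvd_of_map_residue_eq_zero ht h₄
  refine ⟨q₁, q₂, q₃, q₄, rfl, rfl, rfl, rfl, ?_⟩
  apply mul_left_cancel₀ hCt
  rw [mul_zero, ← h']; ring

theorem C_pow_dvd_of_springer (ht : IsLocalRing.maximalIdeal R = Ideal.span {t})
    (ht0 : t ≠ 0) (h2 : IsUnit (2 : R)) (n : ℕ) {p₁ p₂ p₃ p₄ : R[X]}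
    (h : p₁ ^ 2 - (X ^ 2 - 1) * p₂ ^ 2 + C t * (p₃ ^ 2 - (X ^ 2 + 1) * p₄ ^ 2) = 0) :
    C (t ^ n) ∣ p₁ ∧ C (t ^ n) ∣ p₂ ∧ C (t ^ n) ∣ p₃ ∧ C (t ^ n) ∣ p₄ := by
  induction n generalizing p₁ p₂ p₃ p₄ with
  | zero => simp
  | succ n ih =>
    obtain ⟨q₁, q₂, q₃, q₄, rfl, rfl, rfl, rfl, h'⟩ := exists_eq_C_mul_of_springer ht ht0 h2 h
    obtain ⟨h₁, h₂, h₃, h₄⟩ := ih h'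
    simp only [pow_succ', map_mul]
    exact ⟨mul_dvd_mul_left _ h₁, mul_dvd_mul_left _ h₂, mul_dvd_mul_left _ h₃,
      mul_dvd_mul_left _ h₄⟩

/-- The reduction applies again to the quotients, so all coefficients lie in every power of the
maximal ideal and vanish by Krull's intersection theorem. -/
theorem eq_zero_of_springer [IsNoetherianRing R]
    (ht : IsLocalRing.maximalIdeal R = Ideal.span {t})
    (ht0 : t ≠ 0) (h2 : IsUnit (2 : R)) {p₁ p₂ p₃ p₄ : R[X]}
    (h : p₁ ^ 2 - (X ^ 2 - 1) * p₂ ^ 2 + C t * (p₃ ^ 2 - (X ^ 2 + 1) * p₄ ^ 2) = 0) :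
    p₁ = 0 ∧ p₂ = 0 ∧ p₃ = 0 ∧ p₄ = 0 := by
  have key {p : R[X]} (hp : ∀ n, C (t ^ n) ∣ p) : p = 0 := by
    ext i
    rw [coeff_zero]
    have htop : Ideal.span {t} ≠ ⊤ := ht ▸ IsLocalRing.maximalIdeal.isMaximal R |>.ne_top
    have hi := Ideal.iInf_pow_eq_bot_of_isLocalRing _ htop
    rw [← Ideal.mem_bot, ← hi, Ideal.mem_iInf]
    intro n
    rw [Ideal.span_singleton_pow, Ideal.mem_span_singleton]
    exact (C_dvd_iff_dvd_coeff _ _).1 (hp n) i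
  have hall (n : ℕ) := C_pow_dvd_of_springer ht ht0 h2 n h
  exact ⟨key fun n ↦ (hall n).1, key fun n ↦ (hall n).2.1, key fun n ↦ (hall n).2.2.1,
    key fun n ↦ (hall n).2.2.2⟩

variable {K : Type*} [Field K] [Algebra R K] [IsFractionRing R K]

theorem eq_zero_of_springer_of_isFractionRing [IsNoetherianRing R]
    (ht : IsLocalRing.maximalIdeal R = Ideal.span {t})
    (ht0 : t ≠ 0) (h2 : IsUnit (2 : R)) {p : Fin 4 → K[X]}
    (h : p 0 ^ 2 - (X ^ 2 - 1) * p 1 ^ 2 +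
      C (algebraMap R K t) * (p 2 ^ 2 - (X ^ 2 + 1) * p 3 ^ 2) = 0) : p = 0 := by
  let := (mapRingHom (algebraMap R K)).toAlgebra
  have := Polynomial.isLocalization (nonZeroDivisors R) K
  obtain ⟨⟨_, b, hb, rfl⟩, hP⟩ :=
    IsLocalization.exist_integer_multiples_of_finite ((nonZeroDivisors R).map C) p
  choose P hP using hP
  have hinj : Function.Injective (mapRingHom (algebraMap R K)) :=
    map_injective _ (IsFractionRing.injective R K)
  have hP' (i : Fin 4) : mapRingHom (algebraMap R K) (P i) = C (algebraMap R K b) * p i := by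
    have := hP i
    rw [Algebra.smul_def] at this
    change _ = mapRingHom (algebraMap R K) (C b) * p i at this
    rw [coe_mapRingHom, map_C] at this
    exact this
  have hPeq : P 0 ^ 2 - (X ^ 2 - 1) * P 1 ^ 2 + C t * (P 2 ^ 2 - (X ^ 2 + 1) * P 3 ^ 2) = 0 := by
    apply hinj
    simp only [map_add, map_sub, map_mul, map_pow, hP', map_one, map_zero]
    simp only [coe_mapRingHom, map_X, map_C]
    linear_combination C (algebraMap R K b) ^ 2 * h
  have hall := eq_zero_of_springer ht ht0 h2 hPeq
  have hzero (i : Fin 4) : P i = 0 := by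
    fin_cases i
    exacts [hall.1, hall.2.1, hall.2.2.1, hall.2.2.2]
  have hb0 : algebraMap R K b ≠ 0 :=
    (map_ne_zero_iff _ (IsFractionRing.injective R K)).2 (nonZeroDivisors.ne_zero hb)
  ext1 i
  have := hP' i
  rw [hzero, map_zero, eq_comm, mul_eq_zero, C_eq_zero] at this
  exact this.resolve_left hb0

end Reduction

end Polynomial

namespace LocalGlobalForms

open Polynomial in
/-- The form `⟨1, -(Y² - 1), t, -t (Y² + 1)⟩` with `Y = X / t ^ N` is anisotropic. -/
theorem anisotropic_diagForm {K R : Type u} [Field K] [CommRing R] [IsDomain R] [IsLocalRing R]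
    [IsNoetherianRing R] [Algebra R K] [IsFractionRing R K] {t : R}
    (ht : IsLocalRing.maximalIdeal R = Ideal.span {t}) (ht0 : t ≠ 0) (h2 : IsUnit (2 : R)) (N : ℕ)
    {Y p : RatFunc K} (hp : p = RatFunc.C (algebraMap R K t)) (hY : Y = RatFunc.X / p ^ N) :
    (diagForm ![1, -(Y ^ 2 - 1), p, -(p * (Y ^ 2 + 1))]).Anisotropic := by
  intro x hx
  set s : K := algebraMap R K t with hs
  have hs0 : s ≠ 0 := (map_ne_zero_iff _ (IsFractionRing.injective R K)).2 ht0
  have hp0 : p ≠ 0 := by rw [hp]; exact (_root_.map_ne_zero _).2 hs0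
  rw [QuadraticMap.weightedSumSquares_apply, Fin.sum_univ_four] at hx
  simp only [Matrix.cons_val, smul_eq_mul] at hx
  obtain ⟨⟨b, hb⟩, hq⟩ := IsLocalization.exist_integer_multiples_of_finite (nonZeroDivisors K[X]) x
  choose q hq using hq
  have hq' (i : Fin 4) : algebraMap K[X] (RatFunc K) (q i) = algebraMap _ _ b * x i := by
    rw [hq i, Algebra.smul_def]
  have hCp (a : K) : algebraMap K[X] (RatFunc K) (C a) = RatFunc.C a := RatFunc.algebraMap_C a
  have hpoly : C (s ^ N) ^ 2 * q 0 ^ 2 - (X ^ 2 - C (s ^ N) ^ 2) * q 1 ^ 2 +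
      C s * (C (s ^ N) ^ 2 * q 2 ^ 2 - (X ^ 2 + C (s ^ N) ^ 2) * q 3 ^ 2) = 0 := by
    apply RatFunc.algebraMap_injective K
    simp only [map_add, map_sub, map_mul, map_pow, hq', map_zero, hCp, RatFunc.algebraMap_X, ← hp]
    have hX : RatFunc.X = Y * p ^ N := by rw [hY, div_mul_cancel₀ _ (pow_ne_zero N hp0)]
    rw [hX]
    linear_combination (p ^ N) ^ 2 * (algebraMap K[X] (RatFunc K) b) ^ 2 * hx
  -- Substituting `s ^ N * X` for `X` takes `Y` as the new variable; the common factor `s ^ (2N)`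
  -- then cancels.
  have hsub := congrArg (fun r : K[X] ↦ r.comp (C (s ^ N) * X)) hpoly
  simp only [add_comp, sub_comp, mul_comp, pow_comp, C_comp, X_comp, zero_comp] at hsub
  have hsN : (C (s ^ N) : K[X]) ≠ 0 := C_ne_zero.2 (pow_ne_zero N hs0)
  have hq0 : (fun i ↦ (q i).comp (C (s ^ N) * X)) = 0 := by
    apply eq_zero_of_springer_of_isFractionRing ht ht0 h2
    apply mul_left_cancel₀ (pow_ne_zero 2 hsN)
    rw [mul_zero, ← hsub, ← hs]
    ring
  have hb0 : algebraMap K[X] (RatFunc K) b ≠ 0 :=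
    RatFunc.algebraMap_ne_zero (nonZeroDivisors.ne_zero hb)
  ext1 i
  have hqi : q i = 0 := by
    have := congrFun hq0 i
    simp only [Pi.zero_apply] at this
    rw [comp_eq_zero_iff] at this
    refine this.resolve_right fun h ↦ ?_
    have h1 := congrArg (coeff · 1) h.2
    rw [coeff_C_mul, coeff_X_one, mul_one, coeff_C_of_ne_zero one_ne_zero] at h1
    exact pow_ne_zero N hs0 h1
  have := hq' i
  rw [hqi, map_zero, eq_comm, mul_eq_zero] at this
  exact this.resolve_left hb0

end LocalGlobalForms

/-! ### Finiteness of prime divisors on a noetherian model -/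

namespace LocalGlobalForms

section Geometry

attribute [local instance] MvPolynomial.gradedAlgebra

instance isNoetherianRing_homogeneousSubmodule_zero (R : Type u) [CommRing R] [IsNoetherianRing R]
    (n : ℕ) : IsNoetherianRing (MvPolynomial.homogeneousSubmodule (Fin (n + 1)) R 0) := by
  refine isNoetherianRing_of_surjective R _
    (algebraMap R (MvPolynomial.homogeneousSubmodule (Fin (n + 1)) R 0)) ?_
  rintro ⟨p, hp⟩
  rw [MvPolynomial.homogeneousSubmodule_zero] at hp
  obtain ⟨r, rfl⟩ := Submodule.mem_one.1 hp
  exact ⟨r, rfl⟩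

theorem isNoetherian_projSpace (R : Type u) [CommRing R] [IsNoetherianRing R] (n : ℕ) :
    IsNoetherian (projSpace R n) := by
  have : Algebra.FiniteType (MvPolynomial.homogeneousSubmodule (Fin (n + 1)) R 0)
      (MvPolynomial (Fin (n + 1)) R) := by
    refine @Algebra.FiniteType.of_restrictScalars_finiteType R
      (MvPolynomial.homogeneousSubmodule (Fin (n + 1)) R 0) _ _ _ _ _ _ _ ?_ _
    exact @IsScalarTower.of_algebraMap_eq R _ _ _ _ _ _ _ _ fun _ ↦ rfl
  have : IsLocallyNoetherian (projSpace R n) :=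
    LocallyOfFiniteType.isLocallyNoetherian
      (Proj.toSpecZero (MvPolynomial.homogeneousSubmodule (Fin (n + 1)) R))
  have : CompactSpace (projSpace R n) :=
    QuasiCompact.compactSpace_of_compactSpace
      (Proj.toSpecZero (MvPolynomial.homogeneousSubmodule (Fin (n + 1)) R))
  constructor

theorem IsProjectiveOver.isNoetherian {R : Type u} [CommRing R] [IsNoetherianRing R]
    {𝒳 : Scheme.{u}} {f : 𝒳 ⟶ Spec (.of R)} (hf : IsProjectiveOver f) : IsNoetherian 𝒳 := by
  obtain ⟨n, i, hi, -⟩ := hf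
  have := isNoetherian_projSpace R n
  have : IsLocallyNoetherian 𝒳 := LocallyOfFiniteType.isLocallyNoetherian i
  have : CompactSpace 𝒳 := QuasiCompact.compactSpace_of_compactSpace i
  constructor

/-- A nonempty open subset of a noetherian irreducible scheme contains all but finitely many points
of codimension one. -/
theorem finite_coheight_eq_one_notMem {𝒳 : Scheme.{u}} [IsIntegral 𝒳] [IsNoetherian 𝒳]
    (U : 𝒳.Opens) [Nonempty U] : {x : 𝒳 | Order.coheight x = 1 ∧ x ∉ U}.Finite := by
  obtain ⟨S, hS, hcl, hirr, hsup⟩ :=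
    TopologicalSpace.NoetherianSpace.exists_finite_set_isClosed_irreducible
      U.isOpen.isClosed_compl
  refine (hS.preimage (f := fun x : 𝒳 ↦ closure {x}) fun x _ y _ hxy ↦ ?_).subset ?_
  · exact (inseparable_iff_closure_eq.2 hxy).eq
  rintro x ⟨hx, hxU⟩
  obtain ⟨t, htS, hxt⟩ : x ∈ ⋃₀ S := hsup ▸ hxU
  obtain ⟨y, hy⟩ := QuasiSober.sober (hirr t htS) (hcl t htS)
  have hyt : y ∈ t := hy ▸ subset_closure (Set.mem_singleton y)
  have hyU : y ∉ U := by
    have : y ∈ ⋃₀ S := ⟨t, htS, hyt⟩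
    rwa [← hsup] at this
  have hxy : x ≤ y := hy.specializes hxt
  have hyη : y < genericPoint 𝒳 := by
    refine lt_of_le_not_ge ((genericPoint_spec 𝒳).specializes trivial) fun h ↦ hyU ?_
    obtain ⟨z⟩ := ‹Nonempty U›
    exact h.mem_open U.isOpen (((genericPoint_spec 𝒳).specializes trivial).mem_open U.isOpen z.2)
  -- In the order, `x ≤ y` means that `y` specializes to `x`. If `x` were strictly below the generic
  -- point `y` of its component, the chain `x < y < genericPoint 𝒳` would give coheight at least
  -- `2`.
  have hyx : y ≤ x := by
    by_contra hyx
    have h1 := Order.coheight_add_one_le hyη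
    have h2 := Order.coheight_add_one_le (lt_of_le_not_ge hxy hyx)
    rw [hx] at h2
    have h3 := (add_le_add_left ((le_add_self).trans h1) 1).trans h2
    exact absurd h3 (by decide)
  have : closure {x} = t := by
    rw [← hy.def]
    exact (inseparable_iff_closure_eq.1 (Specializes.antisymm hyx hxy))
  rwa [Set.mem_preimage, this]

/-- A nonzero rational function is an invertible section on some nonempty open set. -/
theorem finite_coheight_eq_one_not_isUnit {𝒳 : Scheme.{u}} [IsIntegral 𝒳] [IsNoetherian 𝒳]
    {h : 𝒳.functionField} (hh : h ≠ 0) : {x : 𝒳 | Order.coheight x = 1 ∧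
      ¬ ∃ g : 𝒳.presheaf.stalk x, IsUnit g ∧ algebraMap _ 𝒳.functionField g = h}.Finite := by
  obtain ⟨U, -, g, hU, hg, hu⟩ := exists_isUnit_germ_eq 𝒳 h hh
  refine (finite_coheight_eq_one_notMem U).subset fun x hx ↦ ⟨hx.1, fun hxU ↦ hx.2 ?_⟩
  exact ⟨𝒳.presheaf.germ U x hxU g, hu.map _, by
    rw [Scheme.algebraMap_germ_eq_germToFunctionField, hg]⟩

end Geometry

end LocalGlobalForms

/-! ### Restriction of ℤ-valuations to the henselian field -/

namespace LocalGlobalForms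

section Units

variable {E F : Type u} [Field E] [Field F] {v : Valuation E ℤᵐ⁰}

theorem exists_pow_two_pow_eq (hens : IsHenselianValuation v) (h2 : v 2 = 1)
    (hsep : IsSepClosed (residueField v)) (n : ℕ) {u : E} (hu : v u = 1) :
    ∃ s, v s = 1 ∧ s ^ 2 ^ n = u := by
  induction n generalizing u with
  | zero => exact ⟨u, hu, by simp⟩
  | succ n ih =>
    obtain ⟨r, rfl⟩ := isSquare_of_apply_eq_one hens h2 hsep hu
    have hr : v r = 1 := by
      rw [map_mul, ← pow_two] at hu
      exact (pow_eq_one_iff_of_nonneg zero_le two_ne_zero).1 hu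
    obtain ⟨s, hs, rfl⟩ := ih hr
    exact ⟨s, hs, by rw [pow_succ, pow_mul, pow_two]⟩

/-- Units of the henselian valuation ring are infinitely `2`-divisible, so every valuation with
value group in `ℤ` is trivial on them. -/
theorem apply_map_eq_one_of_apply_eq_one (hens : IsHenselianValuation v) (h2 : v 2 = 1)
    (hsep : IsSepClosed (residueField v)) (ι : E →+* F) (w : Valuation F ℤᵐ⁰) {u : E}
    (hu : v u = 1) : w (ι u) = 1 := by
  have hu0 : w (ι u) ≠ 0 := by
    rw [Valuation.ne_zero_iff, map_ne_zero]
    rintro rfl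
    simp at hu
  have hlog : WithZero.log (w (ι u)) = 0 := by
    obtain ⟨s, -, hs⟩ := exists_pow_two_pow_eq hens h2 hsep
      (WithZero.log (w (ι u))).natAbs hu
    -- The integer `log (w (ι u))` is divisible by a power of `2` exceeding its absolute value.
    apply Int.eq_zero_of_abs_lt_dvd (m := 2 ^ (WithZero.log (w (ι u))).natAbs)
    · nth_rw 2 [← hs]
      rw [map_pow, map_pow, WithZero.log_pow, nsmul_eq_mul]
      exact ⟨_, by push_cast; rfl⟩
    · rw [Int.abs_eq_natAbs]
      exact_mod_cast Nat.lt_two_pow_self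
  rw [← WithZero.exp_log hu0, hlog, WithZero.exp_zero]

/-- The element `1 + t` is a unit of `v`, so `ι t` is a difference of two elements of value `1`. -/
theorem apply_map_le_one (hens : IsHenselianValuation v) (h2 : v 2 = 1)
    (hsep : IsSepClosed (residueField v)) (ι : E →+* F) (w : Valuation F ℤᵐ⁰) {t : E}
    (ht : v t < 1) : w (ι t) ≤ 1 := by
  have h := apply_map_eq_one_of_apply_eq_one hens h2 hsep ι w (Valuation.map_one_add_of_lt v ht)
  have : ι t = ι (1 + t) - 1 := by rw [map_add, map_one, add_sub_cancel_left]
  rw [this]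
  exact w.map_sub_le h.le (map_one _).le

theorem apply_map_eq_one_of_ne_zero (hens : IsHenselianValuation v) (h2 : v 2 = 1)
    (hsep : IsSepClosed (residueField v)) (ι : E →+* F) (w : Valuation F ℤᵐ⁰) {t : E}
    (ht : v t = WithZero.exp (-1)) (hwt : w (ι t) = 1) {e : E} (he : e ≠ 0) : w (ι e) = 1 := by
  have hve : v e ≠ 0 := (Valuation.ne_zero_iff v).2 he
  have ht0 : t ≠ 0 := by
    rintro rfl
    exact WithZero.exp_ne_zero (ht.symm.trans (map_zero v))
  -- Since `v t = exp (-1)`, this power of `t` turns `e` into a unit.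
  have h := apply_map_eq_one_of_apply_eq_one hens h2 hsep ι w (u := e * t ^ WithZero.log (v e)) (by
    rw [map_mul, map_zpow₀, ht, ← WithZero.exp_zsmul]
    nth_rw 1 [← WithZero.exp_log hve]
    rw [← WithZero.exp_add]
    simp)
  rwa [map_mul, map_mul, map_zpow₀, map_zpow₀, hwt, one_zpow, mul_one] at h

theorem maximalIdeal_eq_span (t : v.valuationSubring) (ht : v t = WithZero.exp (-1)) :
    IsLocalRing.maximalIdeal v.valuationSubring = Ideal.span {t} := by
  have ht0 : (t : E) ≠ 0 := fun h ↦
    WithZero.exp_ne_zero (ht.symm.trans (by rw [h, map_zero]))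
  ext a
  rw [Valuation.mem_maximalIdeal_iff, Ideal.mem_span_singleton]
  constructor
  · intro ha
    have hle : v a ≤ WithZero.exp (-1) := by
      by_cases ha0 : v a = 0
      · rw [ha0]; exact zero_le
      · rw [← WithZero.exp_log ha0, ← WithZero.exp_zero, WithZero.exp_lt_exp] at ha
        rw [← WithZero.exp_log ha0, WithZero.exp_le_exp]
        omega
    refine ⟨⟨a / t, ?_⟩, Subtype.ext (mul_div_cancel₀ _ ht0).symm⟩
    rw [Valuation.mem_valuationSubring_iff, map_div₀, ht]
    exact (div_le_one₀ (by simp)).2 hle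
  · rintro ⟨b, rfl⟩
    have hb : v b ≤ 1 := b.2
    change v ((t : E) * b) < 1
    rw [map_mul, ht]
    refine (mul_le_of_le_one_right' hb).trans_lt ?_
    rw [← WithZero.exp_zero, WithZero.exp_lt_exp]
    omega

theorem isNoetherianRing_valuationSubring (v : Valuation E ℤᵐ⁰) [v.IsNontrivial] :
    IsNoetherianRing v.valuationSubring := by
  have := Valuation.valuationSubring_isPrincipalIdealRing v
  infer_instance

end Units

/-! ### Isotropy over the completions -/

section Local

variable {E : Type u} [Field E] {v : Valuation E ℤᵐ⁰}

theorem isSquare_toCompletion_of_one_lt {K : Type u} [Field K] {w : Valuation K ℤᵐ⁰}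
    (h2 : w 2 = 1) {Y : K} (hY : 1 < w Y) : IsSquare (toCompletion w (Y ^ 2 - 1)) := by
  refine isSquare_toCompletion_of_sub_sq h2 (s := Y) ?_ ?_
  · rintro rfl
    simp at hY
  · rw [sub_sub_cancel, map_one, map_pow]
    exact one_lt_pow₀ hY two_ne_zero

open Polynomial in
/-- If `E` is trivially valued and `w` is nontrivial, then the residue of a generator of `E(X)` is
algebraic over `E`. -/
theorem isAlgebraic_residue {w : Valuation (RatFunc E) ℤᵐ⁰} (hw : IsZValuation w)
    [Algebra E w.valuationSubring]
    (halg : ∀ e, (algebraMap E w.valuationSubring e : RatFunc E) = RatFunc.C e)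
    {c : E} {Y : w.valuationSubring} (hY : RatFunc.C c * (Y : RatFunc E) = RatFunc.X) :
    IsAlgebraic E (IsLocalRing.residue w.valuationSubring Y) := by
  by_contra hT
  rw [← Transcendental, transcendental_iff] at hT
  -- As `X = cY`, every polynomial in `X` is one in `Y`. With a transcendental residue it would have
  -- value `1`, making `w` trivial and contradicting surjectivity.
  have hpoly (p : E[X]) (hp : p ≠ 0) : w (algebraMap E[X] (RatFunc E) p) = 1 := by
    set q := p.comp (C c * X) with hq
    have hqp : ((aeval Y q : w.valuationSubring) : RatFunc E) = algebraMap E[X] (RatFunc E) p := by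
      have h1 : ((aeval Y q : w.valuationSubring) : RatFunc E) = eval₂ RatFunc.C (Y : RatFunc E) q := by
        change w.valuationSubring.subtype (aeval Y q) = _
        rw [aeval_def, hom_eval₂]
        congr 1
        ext1 e
        exact halg e
      rw [h1, hq, eval₂_comp, eval₂_mul, eval₂_C, eval₂_X, hY, ← RatFunc.algebraMap_X,
        ← RatFunc.algebraMap_comp_C, ← hom_eval₂, eval₂_C_X]
    have hne : IsLocalRing.residue _ (aeval Y q) ≠ 0 := by
      intro h0
      have hq0 : q = 0 := by
        apply hT
        rw [← h0]
        change _ = algebraMap w.valuationSubring (IsLocalRing.ResidueField _) _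
        rw [← aeval_algebraMap_apply]
        rfl
      apply hp
      apply RatFunc.algebraMap_injective E
      rw [← hqp, hq0, map_zero, map_zero]; rfl
    rw [IsLocalRing.residue_ne_zero_iff_isUnit, ValuationSubring.valuation_eq_one_iff,
      ← (Valuation.isEquiv_valuation_valuationSubring w).eq_one_iff_eq_one, hqp] at hne
    exact hne
  obtain ⟨z, hz⟩ := hw (WithZero.exp 1)
  obtain ⟨p, q, hq, rfl⟩ := IsFractionRing.div_surjective (A := E[X]) z
  have hp : p ≠ 0 := by
    rintro rfl
    exact WithZero.exp_ne_zero (hz.symm.trans (by simp))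
  rw [map_div₀, hpoly p hp, hpoly q (nonZeroDivisors.ne_zero hq), div_one, ← WithZero.exp_zero,
    WithZero.exp_inj] at hz
  omega

theorem isSquare_toCompletion_of_trivial (hens : IsHenselianValuation v) (h2 : v 2 = 1)
    (hsep : IsSepClosed (residueField v)) {w : Valuation (RatFunc E) ℤᵐ⁰} (hw : IsZValuation w)
    (h2w : w 2 = 1) (htriv : ∀ e : E, e ≠ 0 → w (RatFunc.C e) = 1)
    {c : E} {Y : RatFunc E} (hY : RatFunc.C c * Y = RatFunc.X) :
    IsSquare (toCompletion w (Y ^ 2 - 1)) ∨ IsSquare (toCompletion w (Y ^ 2 + 1)) := by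
  rcases lt_or_ge 1 (w Y) with hlt | hle
  · exact Or.inl (isSquare_toCompletion_of_one_lt h2w hlt)
  have hmem (e : E) : RatFunc.C e ∈ w.valuationSubring := by
    rw [Valuation.mem_valuationSubring_iff]
    by_cases he : e = 0
    · simp [he]
    · exact (htriv e he).le
  let := (RingHom.codRestrict (RatFunc.C (K := E)) w.valuationSubring.toSubring hmem).toAlgebra
  obtain ⟨s, hs0, hs⟩ := exists_sq_eq_sq_sub_one_or_sq_add_one hens h2 hsep
    (isAlgebraic_residue hw (fun e ↦ rfl) (c := c) (Y := ⟨Y, hle⟩) hY)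
  obtain ⟨S, rfl⟩ := IsLocalRing.residue_surjective s
  have hlt {z : w.valuationSubring} (hz : IsLocalRing.residue _ S ^ 2 = IsLocalRing.residue _ z) :
      IsSquare (toCompletion w z) := by
    rw [IsLocalRing.residue_ne_zero_iff_isUnit, ValuationSubring.valuation_eq_one_iff,
      ← (Valuation.isEquiv_valuation_valuationSubring w).eq_one_iff_eq_one] at hs0
    rw [← map_pow, ← sub_eq_zero, ← map_sub, IsLocalRing.residue_eq_zero_iff,
      Valuation.mem_maximalIdeal_iff] at hz
    refine isSquare_toCompletion_of_sub_sq h2w (s := S) ?_ ?_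
    · intro h; simp [h] at hs0
    · rw [map_pow w (S : RatFunc E), hs0, one_pow]
      exact hz
  refine hs.imp (fun h ↦ ?_) (fun h ↦ ?_)
  · exact hlt (z := ⟨Y, hle⟩ ^ 2 - 1) (by rw [h, map_sub, map_pow, map_one])
  · exact hlt (z := ⟨Y, hle⟩ ^ 2 + 1) (by rw [h, map_add, map_pow, map_one])

/-- The condition `1 < w z` depends only on the valuation ring, so an exponent found for one
valuation with ring `S` serves all of them. This gives one exponent per point of the scheme. -/
theorem exists_forall_one_lt_apply_div_pow {F : Type u} [Field F] {a p : F} (ha : a ≠ 0)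
    (S : Subring F) : ∃ N : ℕ, ∀ n, N ≤ n → ∀ w : Valuation F ℤᵐ⁰, w.integer = S → w p < 1 →
      p ≠ 0 → 1 < w (a / p ^ n) := by
  by_cases h : ∃ w : Valuation F ℤᵐ⁰, w.integer = S ∧ w p < 1
  · obtain ⟨w₀, hS, hp⟩ := h
    obtain ⟨N, hN⟩ := exists_pow_lt₀ hp (Units.mk0 (w₀ a) ((Valuation.ne_zero_iff _).2 ha))
    refine ⟨N, fun n hn w hw _ hp0 ↦ ?_⟩
    have hmem : a / p ^ n ∉ w.integer := by
      rw [hw, ← hS, Valuation.mem_integer_iff, not_le, map_div₀, map_pow,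
        one_lt_div₀ (pow_pos (zero_lt_iff.2 ((Valuation.ne_zero_iff _).2 hp0)) n)]
      exact (pow_le_pow_right_of_le_one' hp.le hn).trans_lt hN
    rwa [Valuation.mem_integer_iff, not_le] at hmem
  · exact ⟨0, fun n _ w hw hp _ ↦ absurd ⟨w, hw, hp⟩ h⟩

/-- On a noetherian integral scheme, `a / p ^ N` has a pole along every prime divisor on which `p`
vanishes, for large `N`. -/
theorem exists_forall_divisorialValuations_one_lt {𝒳 : Scheme.{u}} [IsIntegral 𝒳]
    [IsNoetherian 𝒳] {F : Type u} [Field F] (φ : 𝒳.functionField ≃+* F) {a p : F} (ha : a ≠ 0)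
    (hp0 : p ≠ 0) :
    ∃ N : ℕ, ∀ w ∈ divisorialValuations 𝒳 φ, w p < 1 → 1 < w (a / p ^ N) := by
  have hfin := finite_coheight_eq_one_not_isUnit (h := φ.symm p) (by simpa using hp0)
  choose N hN using fun x : 𝒳 ↦ exists_forall_one_lt_apply_div_pow (p := p) ha
    (φ.toRingHom.comp (algebraMap (𝒳.presheaf.stalk x) 𝒳.functionField)).range
  obtain ⟨M, hM⟩ := (hfin.image N).bddAbove
  refine ⟨M, fun w hw hwp ↦ ?_⟩
  obtain ⟨-, x, hx, hxw⟩ := hw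
  -- It remains to see that `x` is in the finite exceptional set: were `p` a unit at `x`, then `p⁻¹`
  -- would be integral, against `w p < 1`.
  refine hN x M (hM ⟨x, ⟨hx, ?_⟩, rfl⟩) w hxw hwp hp0
  rintro ⟨g, hg, hgp⟩
  have hmem : p⁻¹ ∈ w.integer := by
    rw [hxw]
    obtain ⟨g, rfl⟩ := hg
    refine ⟨↑g⁻¹, ?_⟩
    have h1 : φ (algebraMap _ 𝒳.functionField (g : 𝒳.presheaf.stalk x)) = p := by rw [hgp]; simp
    apply eq_inv_of_mul_eq_one_left
    rw [← h1]
    change φ (algebraMap _ _ _) * _ = 1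
    rw [← map_mul, ← map_mul, Units.inv_mul, map_one, map_one]
  rw [Valuation.mem_integer_iff, map_inv₀] at hmem
  exact absurd hwp (not_lt.2 ((inv_le_one₀ (zero_lt_iff.2 ((Valuation.ne_zero_iff w).2 hp0))).1 hmem))

end Local

end LocalGlobalForms

end

/-! ### The anisotropic, locally isotropic form -/

theorem corollary2 {E : Type u} [Field E] (v : Valuation E ℤᵐ⁰)
    (hv : LocalGlobalForms.IsZValuation v) (hens : LocalGlobalForms.IsHenselianValuation v)
    (h2 : v 2 = 1) (hsep : IsSepClosed (LocalGlobalForms.residueField v))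
    (𝒳 : Scheme.{u}) [IsIntegral 𝒳] (f : 𝒳 ⟶ Spec (.of v.valuationSubring))
    (hX : LocalGlobalForms.IsModel v.valuationSubring (RatFunc E) 𝒳 f)
    (φ : 𝒳.functionField ≃+* RatFunc E) :
    ∃ a : Fin 4 → RatFunc E, (∀ i, a i ≠ 0) ∧ (LocalGlobalForms.diagForm a).Anisotropic ∧
      ∀ w ∈ LocalGlobalForms.divisorialValuations 𝒳 φ,
        ¬ (LocalGlobalForms.diagForm
            fun i => LocalGlobalForms.toCompletion w (a i)).Anisotropic := by
  open LocalGlobalForms in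
  obtain ⟨t, ht⟩ := hv (WithZero.exp (-1))
  have ht1 : v t < 1 := by
    rw [ht, ← WithZero.exp_zero, WithZero.exp_lt_exp]
    omega
  have ht0 : t ≠ 0 := by
    rintro rfl
    exact WithZero.exp_ne_zero (ht.symm.trans (map_zero v))
  have : v.IsNontrivial := ⟨t, (Valuation.ne_zero_iff v).2 ht0, ht1.ne⟩
  have := isNoetherianRing_valuationSubring v
  have : IsNoetherian 𝒳 := hX.projective.isNoetherian
  let τ : v.valuationSubring := ⟨t, ht1.le⟩
  have hunit : IsUnit (2 : v.valuationSubring) := by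
    rw [ValuationSubring.valuation_eq_one_iff,
      ← (Valuation.isEquiv_valuation_valuationSubring v).eq_one_iff_eq_one]
    exact h2
  set p : RatFunc E := RatFunc.C t with hp
  have hp0 : p ≠ 0 := (map_ne_zero _).2 ht0
  obtain ⟨N, hN⟩ := exists_forall_divisorialValuations_one_lt φ RatFunc.X_ne_zero hp0
  set Y : RatFunc E := RatFunc.X / p ^ N with hY
  have haniso : (diagForm ![1, -(Y ^ 2 - 1), p, -(p * (Y ^ 2 + 1))]).Anisotropic :=
    anisotropic_diagForm (maximalIdeal_eq_span τ ht) (by simpa [τ, Subtype.ext_iff] using ht0)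
      hunit N rfl rfl
  refine ⟨_, fun i hi ↦ ?_, haniso, fun w hw ↦ ?_⟩
  -- A zero coefficient would make a basis vector isotropic.
  · have h := haniso (Pi.single i 1) (by
      rw [QuadraticMap.weightedSumSquares_apply]
      refine Finset.sum_eq_zero fun j _ ↦ ?_
      by_cases hj : j = i
      · rw [hj, hi, zero_smul]
      · simp [Pi.single_eq_of_ne hj])
    simpa using congrFun h i
  have h2w : w 2 = 1 := by
    have := apply_map_eq_one_of_apply_eq_one hens h2 hsep (RatFunc.C (K := E)) w h2
    rwa [map_ofNat] at this
  refine not_anisotropic_of_isSquare (f := toCompletion w (Y ^ 2 - 1))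
    (g := toCompletion w (Y ^ 2 + 1)) (p := toCompletion w p) ?_ ?_
  · ext i
    fin_cases i
    · exact map_one _
    · exact map_neg _ _
    · rfl
    · exact (map_neg _ _).trans (congrArg _ (map_mul _ _ _))
  -- Either `t` vanishes along the divisor, and the choice of `N` gives `Y` a pole, or `w` is
  -- trivial on `E`.
  rcases (apply_map_le_one hens h2 hsep (RatFunc.C (K := E)) w ht1).lt_or_eq with hlt | heq
  · exact Or.inl (isSquare_toCompletion_of_one_lt h2w (hN w hw hlt))
  · refine isSquare_toCompletion_of_trivial hens h2 hsep hw.1 h2w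
      (fun e he ↦ apply_map_eq_one_of_ne_zero hens h2 hsep RatFunc.C w ht heq he) (c := t ^ N) ?_
    rw [map_pow, ← hp, hY, mul_div_cancel₀ _ (pow_ne_zero N hp0)]
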